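/- Let $\mathcal M=(\mathcal S,\mathcal A,\mathcal R,p)$ be a finite MDP ($\mathcal S,\mathcal A$ nonempty finite sets of states and actions, $\mathcal R\subset\mathbb R$ a finite set of rewards, $p(s',r\mid s,a)$ the dynamics) and let $\mathcal O$ be a nonempty finite set of options. Each option $o$ has a policy $\pi(a\mid s,o)$ and termination probabilities $\beta(s,o)\in[0,1]$, and may be initiated in every state: started in $s$, it chooses actions from $\pi(\cdot\mid\cdot,o)$ and, on each arrival in a state $s'$, terminates with probability $\beta(s',o)$. Assume that the expected length of every option from every state is finite (in particular, it terminates almost surely). A policy $\mu(o\mid s)$ is a stationary randomized choice of an option in each state; whenever an option terminates in $s'$, the next one is drawn from $\mu(\cdot\mid s')$. Let $\Pi$ be the set of all such policies. Unichain assumption: for every $\mu\in\Pi$, the Markov chain on $\mathcal S$ of the states $\hat S_0,\hat S_1,\dots$ in which successive options are initiated has exactly one recurrent class (and possibly transient states). Let $\hat R_i,\hat L_i$ be the cumulative reward and the length of the $i$-th option, and $r(\mu)=\lim_{n\to\infty}\mathbb E_\mu[\sum_{i=0}^n\hat R_i\mid \hat S_0=s,\hat O_0=o]\,/\,\mathbb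 E_\mu[\sum_{i=0}^n\hat L_i\mid \hat S_0=s,\hat O_0=o]$, which exists, does not depend on $(s,o)$, and equals $\lim_{t\to\infty}\frac1t\mathbb E_\mu[\sum_{i=1}^tR_i\mid S_0=s,O_0=o]$; let $r_*=\sup_{\mu\in\Pi}r(\mu)<\infty$. Let $q_\mu(s,o)=\sum_{t\ge1}\mathbb E_\mu[R_t-r(\mu)\mid S_0=s,O_0=o]$, the series being summed in the sense of Cesàro (this sum exists). For $q\in\mathbb R^{\mathcal S\times\mathcal O}$, $\bar r\in\mathbb R$ consider the intra-option Bellman equation $$q(s,o)=\sum_a\pi(a\mid s,o)\sum_{s',r}p(s',r\mid s,a)\big(r-\bar r+u^q(s',o)\big)\quad\text{for all }s,o,$$ where in the optimality equation $u^q(s',o)=(1-\beta(s',o))q(s',o)+\beta(s',o)\max_{o'}q(s',o')$, and in the evaluation equation for $\mu$ $u^q(s',o)=(1-\beta(s',o))q(s',o)+\beta(s',o)\sum_{o'}\mu(o'\mid s')q(s',o')$. Let $e$ be the all-one vector. Then: 1. (a) The optimality equation has a solution $(\bar r,q)$. (b) Every solution has $\bar r=r_*$, and if $q_1$ is one solution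 for $q$, then the set of all solutions for $q$ is $\{q_1+ce\mid c\in\mathbb R\}$. (c) If $q$ is a solution and $\mu\in\Pi$ is greedy with respect to $q$ (that is, $\mu(o\mid s)>0$ implies $q(s,o)=\max_{o'}q(s,o')$), then $r(\mu)=r_*$. 2. For every $\mu\in\Pi$: (a) the evaluation equation for $\mu$ has a solution $(\bar r,q)$. (b) Every solution has $\bar r=r(\mu)$, and the set of all solutions for $q$ is $\{q_\mu+ce\mid c\in\mathbb R\}$. -/

import Mathlib

open Filter Topology

noncomputable section

namespace AvgOptions

/-- A finite Markov decision process with states `S`, actions `A`, a finite set of real rewards,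
and dynamics `p s a s' r`, the probability of next state `s'` and reward `r`. -/
structure FiniteMDP (S A : Type*) [Fintype S] [Fintype A] where
  rewards : Finset ℝ
  p : S → A → S → rewards → ℝ
  p_nonneg : ∀ s a s' r, 0 ≤ p s a s' r
  p_sum : ∀ s a, ∑ s', ∑ r, p s a s' r = 1

/-- An option: a stochastic policy `pi s a` over actions, and the probability `beta s` that the
option terminates on arrival in the state `s`. It may be initiated in every state. -/
structure TemporalOption (S A : Type*) [Fintype A] where
  pi : S → A → ℝ
  pi_nonneg : ∀ s a, 0 ≤ pi s a
  pi_sum : ∀ s, ∑ a, pi s a = 1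
  beta : S → ℝ
  beta_nonneg : ∀ s, 0 ≤ beta s
  beta_le_one : ∀ s, beta s ≤ 1

/-- A (stationary, randomized) policy over options; `prob s o` is the probability of choosing
the option `o` in the state `s`. -/
structure Policy (S O : Type*) [Fintype O] where
  prob : S → O → ℝ
  prob_nonneg : ∀ s o, 0 ≤ prob s o
  prob_sum : ∀ s, ∑ o, prob s o = 1

variable {S A O : Type*} [Fintype S] [Fintype A] [Fintype O]

/-! ### Execution of a single option until termination -/

/-- The probability that the option `w`, initiated in `s`, runs for exactly `l + 1` steps and
produces the successive actions, next states and rewards listed in `τ`. -/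
def execProb (M : FiniteMDP S A) (w : TemporalOption S A) :
    (l : ℕ) → S → (Fin (l + 1) → A × S × M.rewards) → ℝ
  | 0, s, τ =>
      w.pi s (τ 0).1 * M.p s (τ 0).1 (τ 0).2.1 (τ 0).2.2 * w.beta (τ 0).2.1
  | l + 1, s, τ =>
      w.pi s (τ 0).1 * M.p s (τ 0).1 (τ 0).2.1 (τ 0).2.2 * (1 - w.beta (τ 0).2.1) *
        execProb M w l (τ 0).2.1 (Fin.tail τ)

/-- The probability that the option `w`, initiated in `s`, has length exactly `l + 1`. -/
def lengthProb (M : FiniteMDP S A) (w : TemporalOption S A) (s : S) (l : ℕ) : ℝ :=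
  ∑ τ : Fin (l + 1) → A × S × M.rewards, execProb M w l s τ

/-- The length of the option `w`, initiated in `s`, is almost surely finite and has a finite
expectation. -/
def FiniteMeanLength (M : FiniteMDP S A) (w : TemporalOption S A) (s : S) : Prop :=
  HasSum (fun l => lengthProb M w s l) 1 ∧
    Summable (fun l : ℕ => ((l : ℝ) + 1) * lengthProb M w s l)

/-- The probability that the option `w`, initiated in `s`, terminates in `s'`. -/
def termProb [DecidableEq S] (M : FiniteMDP S A) (w : TemporalOption S A) (s s' : S) : ℝ :=
  ∑' l : ℕ, ∑ τ : Fin (l + 1) → A × S × M.rewards,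
    execProb M w l s τ * (if (τ (Fin.last l)).2.1 = s' then 1 else 0)

/-- The expected cumulative reward during the execution of `w` initiated in `s`. -/
def meanOptionReward (M : FiniteMDP S A) (w : TemporalOption S A) (s : S) : ℝ :=
  ∑' l : ℕ, ∑ τ : Fin (l + 1) → A × S × M.rewards,
    execProb M w l s τ * ∑ i, ((τ i).2.2 : ℝ)

/-- The expected length of the execution of `w` initiated in `s`. -/
def meanOptionLength (M : FiniteMDP S A) (w : TemporalOption S A) (s : S) : ℝ :=
  ∑' l : ℕ, ((l : ℝ) + 1) * lengthProb M w s l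

/-! ### The unichain condition -/

/-- `C` is a recurrent class of the finite Markov chain with transition matrix `K`:
a nonempty closed set of states that all communicate with each other. -/
def IsRecurrentClass [DecidableEq S] (K : Matrix S S ℝ) (C : Set S) : Prop :=
  C.Nonempty ∧ (∀ s ∈ C, ∀ s' ∉ C, K s s' = 0) ∧
    ∀ s ∈ C, ∀ s' ∈ C, ∃ n : ℕ, 0 < (K ^ n) s s'

/-- Exactly one recurrent class (all other states being transient). -/
def IsUnichain [DecidableEq S] (K : Matrix S S ℝ) : Prop :=
  ∃! C : Set S, IsRecurrentClass K C

/-- The Markov chain of the states in which successive options are initiated when options are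
chosen by `μ`. -/
def inducedChain [DecidableEq S] (M : FiniteMDP S A) (opt : O → TemporalOption S A)
    (μ : Policy S O) : Matrix S S ℝ :=
  fun s s' => ∑ o, μ.prob s o * termProb M (opt o) s s'

/-! ### Reward rate -/

/-- Transition matrix of (initiation state, option) from one option to the next. -/
def decisionChain [DecidableEq S] (M : FiniteMDP S A) (opt : O → TemporalOption S A)
    (μ : Policy S O) : Matrix (S × O) (S × O) ℝ :=
  fun x y => termProb M (opt x.2) x.1 y.1 * μ.prob y.1 y.2

/-- The ratio of the expected total reward to the expected total length of the options number
`0, …, n`, when the first option is `o`, initiated in `s`. -/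
def optionRatio [DecidableEq S] [DecidableEq O] (M : FiniteMDP S A)
    (opt : O → TemporalOption S A) (μ : Policy S O) (s : S) (o : O) (n : ℕ) : ℝ :=
  (∑ i ∈ Finset.range (n + 1), ∑ y : S × O,
      (decisionChain M opt μ ^ i) (s, o) y * meanOptionReward M (opt y.2) y.1) /
    (∑ i ∈ Finset.range (n + 1), ∑ y : S × O,
      (decisionChain M opt μ ^ i) (s, o) y * meanOptionLength M (opt y.2) y.1)

/-- The reward rate of `μ` from the initial state `s` and initial option `o`. -/
def rewardRateFrom [DecidableEq S] [DecidableEq O] (M : FiniteMDP S A)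
    (opt : O → TemporalOption S A) (μ : Policy S O) (s : S) (o : O) : ℝ :=
  limUnder atTop (optionRatio M opt μ s o)

/-- The reward rate `r(μ)`, read off at some initial state and option; the initial pair is
immaterial where the reward rate does not depend on it. -/
def rewardRate [DecidableEq S] [DecidableEq O] [Nonempty S] [Nonempty O] (M : FiniteMDP S A)
    (opt : O → TemporalOption S A) (μ : Policy S O) : ℝ :=
  rewardRateFrom M opt μ (Classical.arbitrary S) (Classical.arbitrary O)

/-- The optimal reward rate. -/
def optimalRate [DecidableEq S] [DecidableEq O] [Nonempty S] [Nonempty O] (M : FiniteMDP S A)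
    (opt : O → TemporalOption S A) : ℝ :=
  ⨆ μ : Policy S O, rewardRate M opt μ

/-! ### The process at the level of single time steps -/

/-- Given state `s` and executing option `o`, the probability of action `a`, next state `s'`,
reward `r` and next executing option `o'`, where `z = (a, s', r, o')`: the option `o` terminates
in `s'` and `μ` chooses `o'`, or it continues and `o' = o`. -/
def stepProb [DecidableEq O] (M : FiniteMDP S A) (opt : O → TemporalOption S A)
    (μ : Policy S O) (s : S) (o : O) (z : A × S × M.rewards × O) : ℝ :=
  (opt o).pi s z.1 * M.p s z.1 z.2.1 z.2.2.1 *
    ((opt o).beta z.2.1 * μ.prob z.2.1 z.2.2.2 +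
      (1 - (opt o).beta z.2.1) * (if z.2.2.2 = o then 1 else 0))

/-- The probability of the trajectory `τ` of the first `n` steps, started at `(s, o)`. -/
def trajProb [DecidableEq O] (M : FiniteMDP S A) (opt : O → TemporalOption S A)
    (μ : Policy S O) : (n : ℕ) → S → O → (Fin n → A × S × M.rewards × O) → ℝ
  | 0, _, _, _ => 1
  | n + 1, s, o, τ =>
      stepProb M opt μ s o (τ 0) *
        trajProb M opt μ n (τ 0).2.1 (τ 0).2.2.2 (Fin.tail τ)

/-- The expectation of `R₁ - c + ⋯ + Rₙ - c`, started at `(s, o)`. -/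
def expectedReturn [DecidableEq O] (M : FiniteMDP S A) (opt : O → TemporalOption S A)
    (μ : Policy S O) (c : ℝ) (s : S) (o : O) (n : ℕ) : ℝ :=
  ∑ τ : Fin n → A × S × M.rewards × O,
    trajProb M opt μ n s o τ * ∑ i, (((τ i).2.2.1 : ℝ) - c)

/-- The averages of the first partial sums of the series
`𝔼[R₁ - r(μ)] + 𝔼[R₂ - r(μ)] + ⋯`, started at `(s, o)`. -/
def cesaroReturn [DecidableEq S] [DecidableEq O] [Nonempty S] [Nonempty O]
    (M : FiniteMDP S A) (opt : O → TemporalOption S A) (μ : Policy S O) (s : S) (o : O)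
    (N : ℕ) : ℝ :=
  (∑ n ∈ Finset.Icc 1 N, expectedReturn M opt μ (rewardRate M opt μ) s o n) / N

/-- The differential option-value function `q_μ`: the sum of the above series, in the sense of
Cesàro (the ordinary sum wherever the series converges; it need not for periodic chains). -/
def diffValue [DecidableEq S] [DecidableEq O] [Nonempty S] [Nonempty O]
    (M : FiniteMDP S A) (opt : O → TemporalOption S A) (μ : Policy S O) (s : S) (o : O) : ℝ :=
  limUnder atTop (cesaroReturn M opt μ s o)

/-! ### Intra-option Bellman equations -/

/-- The general intra-option equation, for given `u s' o`. -/
def IntraOptionEq (M : FiniteMDP S A) (opt : O → TemporalOption S A)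
    (u : S → O → ℝ) (rbar : ℝ) (q : S → O → ℝ) : Prop :=
  ∀ s o, q s o = ∑ a, (opt o).pi s a * ∑ s', ∑ r : M.rewards,
    M.p s a s' r * ((r : ℝ) - rbar + u s' o)

def uOpt [Nonempty O] (opt : O → TemporalOption S A) (q : S → O → ℝ) (s' : S) (o : O) : ℝ :=
  (1 - (opt o).beta s') * q s' o +
    (opt o).beta s' * Finset.univ.sup' Finset.univ_nonempty (fun o' => q s' o')

def uEval (opt : O → TemporalOption S A) (μ : Policy S O) (q : S → O → ℝ) (s' : S) (o : O) : ℝ :=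
  (1 - (opt o).beta s') * q s' o + (opt o).beta s' * ∑ o', μ.prob s' o' * q s' o'

/-- `(rbar, q)` solves the intra-option optimality equation. -/
def OptimalityEq [Nonempty O] (M : FiniteMDP S A) (opt : O → TemporalOption S A)
    (rbar : ℝ) (q : S → O → ℝ) : Prop :=
  IntraOptionEq M opt (uOpt opt q) rbar q

/-- `(rbar, q)` solves the intra-option evaluation equation for `μ`. -/
def EvaluationEq (M : FiniteMDP S A) (opt : O → TemporalOption S A) (μ : Policy S O)
    (rbar : ℝ) (q : S → O → ℝ) : Prop :=
  IntraOptionEq M opt (uEval opt μ q) rbar q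

/-- `μ` chooses only options that maximize `q s ·`. -/
def IsGreedy (μ : Policy S O) (q : S → O → ℝ) : Prop :=
  ∀ s o, 0 < μ.prob s o → ∀ o', q s o' ≤ q s o

end AvgOptions

end

open AvgOptions

/-!
Everything rests on two facts about a finite stochastic matrix `P`. If the only harmonic functions
of `P` are the constants, the Poisson equation `R = c + q - P q` is solvable, and summing it along
the powers of `P` identifies `c` as the long-run average of `R`. If the chain is unichain, a
function that is subharmonic where it is maximal and superharmonic elsewhere is constant: otherwise
the level sets of its maximum and of its minimum would be disjoint absorbing sets, each containing
a recurrent class.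

The evaluation equation for `μ` is the Poisson equation of the chain of pairs (state, executed
option). Solving the intra-option equation along one execution of an option expresses a solution
through its values at termination, so that harmonic functions of that chain come from harmonic
functions of the induced chain on states, which are constant. The same reduction turns a solution
of the evaluation equation into a solution of the Poisson equation of the option-level chain, with
option rewards and option lengths; this computes the reward rate.

For two solutions `q₁`, `q₂` of the optimality equation, `g = max q₂ - max q₁` is subharmonic for
policies greedy for `q₂` and superharmonic for policies greedy for `q₁`; following `q₂` where `g` is
maximal and `q₁` elsewhere, `g` is constant. A solution exists by vanishing discount: the discounted
optimality equation is a contraction, and its solution, shifted by a constant, stays in a compact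
set that is independent of the discount factor, because only finitely many deterministic policies
are greedy.
-/

namespace AvgOptions

open Matrix

noncomputable section

section StochasticMatrix

variable {X : Type*} [Fintype X] [DecidableEq X] {P : Matrix X X ℝ}

theorem mulVec_smul_one (hP : P ∈ rowStochastic ℝ X) (c : ℝ) : P *ᵥ (c • 1) = c • 1 := by
  rw [mulVec_smul, one_vecMul_of_mem_rowStochastic hP]

theorem mulVec_mono (hP : P ∈ rowStochastic ℝ X) : Monotone (P *ᵥ ·) := fun v w hvw x => by
  have h := nonneg_mulVec_of_mem_rowStochastic hP (x := w - v) (fun y => sub_nonneg.2 (hvw y)) x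
  rwa [mulVec_sub, Pi.sub_apply, sub_nonneg] at h

theorem norm_mulVec_le (hP : P ∈ rowStochastic ℝ X) (v : X → ℝ) : ‖P *ᵥ v‖ ≤ ‖v‖ := by
  have hv : v ≤ ‖v‖ • 1 := fun x => by simpa using (le_abs_self _).trans (norm_le_pi_norm v x)
  have hv' : (-‖v‖) • 1 ≤ v := fun x => by simpa using neg_le_of_abs_le (norm_le_pi_norm v x)
  refine (pi_norm_le_iff_of_nonneg (norm_nonneg v)).2 fun x => abs_le.2 ⟨?_, ?_⟩
  · simpa only [mulVec_smul_one hP, Pi.smul_apply, Pi.one_apply, smul_eq_mul, mul_one]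
      using mulVec_mono hP hv' x
  · simpa only [mulVec_smul_one hP, Pi.smul_apply, Pi.one_apply, smul_eq_mul, mul_one]
      using mulVec_mono hP hv x

theorem nonpos_of_add_mulVec_le [Nonempty X] (hP : P ∈ rowStochastic ℝ X) {a : ℝ} {d : X → ℝ}
    (h : ∀ x, a + (P *ᵥ d) x ≤ d x) : a ≤ 0 := by
  obtain ⟨x, hx⟩ := Finite.exists_min d
  have hle : d x • 1 ≤ d := fun y => by simpa using hx y
  have hmean : d x ≤ (P *ᵥ d) x := by simpa [mulVec_smul_one hP] using mulVec_mono hP hle x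
  linarith [h x]

theorem sum_range_pow_mulVec_sub {R : Type*} [Ring R] (P : Matrix X X R) (q : X → R) (n : ℕ) :
    ∑ i ∈ Finset.range n, P ^ i *ᵥ (q - P *ᵥ q) = q - P ^ n *ᵥ q := by
  simp only [mulVec_sub, mulVec_mulVec, ← pow_succ]
  rw [Finset.sum_range_sub', pow_zero, one_mulVec]

theorem tendsto_sum_range_pow_mulVec_atTop (hP : P ∈ rowStochastic ℝ X) {T : X → ℝ}
    (hT : ∀ x, 0 < T x) (x : X) :
    Tendsto (fun n => ∑ i ∈ Finset.range n, (P ^ i *ᵥ T) x) atTop atTop := by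
  have : Nonempty X := ⟨x⟩
  obtain ⟨y, hy⟩ := Finite.exists_min T
  have hle : T y • 1 ≤ T := fun z => by simpa using hy z
  have hterm : ∀ i, T y ≤ (P ^ i *ᵥ T) x := fun i => by
    simpa [mulVec_smul_one (pow_mem hP i)] using mulVec_mono (pow_mem hP i) hle x
  refine tendsto_atTop_mono (fun n => ?_) (tendsto_natCast_atTop_atTop.atTop_mul_const (hT y))
  simpa using Finset.card_nsmul_le_sum (Finset.range n) _ _ fun i _ => hterm i

theorem tendsto_sum_pow_mulVec_div (hP : P ∈ rowStochastic ℝ X) {R T q : X → ℝ} {c : ℝ}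
    (hT : ∀ x, 0 < T x) (hR : R = c • T + (q - P *ᵥ q)) (x : X) :
    Tendsto (fun n => (∑ i ∈ Finset.range n, (P ^ i *ᵥ R) x) /
      ∑ i ∈ Finset.range n, (P ^ i *ᵥ T) x) atTop (𝓝 c) := by
  set D : ℕ → ℝ := fun n => ∑ i ∈ Finset.range n, (P ^ i *ᵥ T) x with hD
  have hDtop : Tendsto D atTop atTop := tendsto_sum_range_pow_mulVec_atTop hP hT x
  have hsum : ∀ n, ∑ i ∈ Finset.range n, (P ^ i *ᵥ R) x = c * D n + (q x - (P ^ n *ᵥ q) x) := by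
    intro n
    rw [hR, ← Pi.sub_apply, ← sum_range_pow_mulVec_sub P q n]
    simp only [mulVec_add, mulVec_smul, Pi.add_apply, Pi.smul_apply, smul_eq_mul,
      Finset.sum_add_distrib, Finset.sum_apply, hD, Finset.mul_sum]
  have hbdd : ∀ n, |q x - (P ^ n *ᵥ q) x| ≤ ‖q‖ + ‖q‖ := fun n =>
    (norm_le_pi_norm (q - P ^ n *ᵥ q) x).trans <| (norm_sub_le _ _).trans <| by
      gcongr
      exact norm_mulVec_le (pow_mem hP n) q
  have hzero : Tendsto (fun n => (q x - (P ^ n *ᵥ q) x) / D n) atTop (𝓝 0) :=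
    tendsto_bdd_div_atTop_nhds_zero (.of_forall fun n => (abs_le.1 (hbdd n)).1)
      (.of_forall fun n => (abs_le.1 (hbdd n)).2) hDtop
  have hlim := hzero.const_add c
  rw [add_zero] at hlim
  refine hlim.congr' ?_
  filter_upwards [hDtop.eventually_gt_atTop 0] with n hn
  rw [hsum, add_div, mul_div_cancel_right₀ _ hn.ne']

theorem tendsto_sum_pow_mulVec_div_natCast (hP : P ∈ rowStochastic ℝ X) {R q : X → ℝ} {c : ℝ}
    (hR : R = c • 1 + (q - P *ᵥ q)) (x : X) :
    Tendsto (fun n : ℕ => (∑ i ∈ Finset.range n, (P ^ i *ᵥ R) x) / n) atTop (𝓝 c) := by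
  refine (tendsto_sum_pow_mulVec_div hP (fun _ => one_pos) hR x).congr fun n => ?_
  have hone : ∀ i, (P ^ i *ᵥ fun _ => (1 : ℝ)) x = 1 := fun i =>
    congrFun (one_vecMul_of_mem_rowStochastic (pow_mem hP i)) x
  simp [hone]

theorem exists_poisson_solution [Nonempty X] (hP : P ∈ rowStochastic ℝ X)
    (hharm : ∀ h : X → ℝ, P *ᵥ h = h → ∃ c : ℝ, h = c • 1) (R : X → ℝ) :
    ∃ (c : ℝ) (q : X → ℝ), R = c • 1 + (q - P *ᵥ q) := by
  have ⟨x₀⟩ := ‹Nonempty X›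
  -- Normalising `q x₀ = c` makes the equation linear in `q` alone, with as many unknowns as
  -- equations, so solvability reduces to uniqueness.
  let Φ : (X → ℝ) →ₗ[ℝ] (X → ℝ) :=
    LinearMap.id - P.mulVecLin + (LinearMap.proj x₀).smulRight (1 : X → ℝ)
  have hΦ : ∀ v, Φ v = v x₀ • 1 + (v - P *ᵥ v) := fun v => add_comm _ _
  have hinj : Function.Injective Φ := by
    refine (injective_iff_map_eq_zero Φ).2 fun v hv => ?_
    rw [hΦ] at hv
    have hpt : ∀ x, v x₀ + (v x - (P *ᵥ v) x) = 0 := fun x => by simpa using congrFun hv x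
    have hle : v x₀ ≤ 0 := nonpos_of_add_mulVec_le hP (d := -v) fun x => by
      simp only [mulVec_neg, Pi.neg_apply]
      linarith [hpt x]
    have hge : -v x₀ ≤ 0 := nonpos_of_add_mulVec_le hP (d := v) fun x => by linarith [hpt x]
    have hv₀ : v x₀ = 0 := by linarith
    obtain ⟨c, rfl⟩ := hharm v (funext fun x => by linarith [hpt x])
    have hc : c = 0 := by simpa using hv₀
    rw [hc, zero_smul]
  obtain ⟨q, hq⟩ := LinearMap.injective_iff_surjective.1 hinj R
  exact ⟨q x₀, q, by rw [← hq, hΦ]⟩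

theorem norm_discounted_le_two_mul (hP : P ∈ rowStochastic ℝ X) {γ : ℝ} (hγ : 0 ≤ γ)
    (hγ1 : γ < 1) {R v w : X → ℝ} (hv : v = R + P *ᵥ v) (hw : w = R + γ • (P *ᵥ w)) :
    ‖w‖ ≤ 2 * ‖v‖ := by
  have hsub : w - v = γ • (P *ᵥ (w - v)) - (1 - γ) • (P *ᵥ v) := by
    nth_rewrite 1 [hv, hw]
    rw [mulVec_sub]
    module
  have hnorm : ‖w - v‖ ≤ γ * ‖w - v‖ + (1 - γ) * ‖v‖ := by
    have hPwv := norm_mulVec_le hP (w - v)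
    have hPv := norm_mulVec_le hP v
    calc ‖w - v‖ = ‖γ • (P *ᵥ (w - v)) - (1 - γ) • (P *ᵥ v)‖ := congrArg _ hsub
      _ ≤ γ * ‖P *ᵥ (w - v)‖ + (1 - γ) * ‖P *ᵥ v‖ := by
        refine (norm_sub_le _ _).trans_eq ?_
        rw [norm_smul_of_nonneg hγ, norm_smul_of_nonneg (sub_nonneg.2 hγ1.le)]
      _ ≤ γ * ‖w - v‖ + (1 - γ) * ‖v‖ := by
        have := sub_nonneg.2 hγ1.le
        gcongr
  have hwv : ‖w - v‖ ≤ ‖v‖ := by nlinarith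
  calc ‖w‖ = ‖w - v + v‖ := by rw [sub_add_cancel]
    _ ≤ 2 * ‖v‖ := by linarith [norm_add_le (w - v) v]

end StochasticMatrix

theorem contractingWith_of_monotone_of_map_add_smul_one_le {X : Type*} [Fintype X]
    {F : (X → ℝ) → X → ℝ} {γ : NNReal} (hγ : γ < 1) (hF : Monotone F)
    (hadd : ∀ (q : X → ℝ) (c : ℝ), 0 ≤ c → F (q + c • 1) ≤ F q + (γ * c) • 1) :
    ContractingWith γ F := by
  have key : ∀ q₁ q₂ : X → ℝ, F q₁ ≤ F q₂ + (γ * ‖q₁ - q₂‖) • 1 := fun q₁ q₂ => by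
    refine (hF fun x => ?_).trans (hadd q₂ _ (norm_nonneg _))
    have := (le_abs_self _).trans (norm_le_pi_norm (q₁ - q₂) x)
    simp only [Pi.sub_apply, Pi.add_apply, Pi.smul_apply, Pi.one_apply, smul_eq_mul,
      mul_one] at this ⊢
    linarith
  refine ⟨hγ, LipschitzWith.of_dist_le_mul fun q₁ q₂ => ?_⟩
  simp only [dist_eq_norm]
  refine (pi_norm_le_iff_of_nonneg (by positivity)).2 fun x => abs_le.2 ?_
  have h₁₂ := key q₁ q₂ x
  have h₂₁ := key q₂ q₁ x
  rw [norm_sub_rev] at h₂₁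
  simp only [Pi.sub_apply, Pi.add_apply, Pi.smul_apply, Pi.one_apply, smul_eq_mul,
    mul_one] at h₁₂ h₂₁ ⊢
  constructor <;> linarith

section RecurrentClass

variable {S : Type*} [Fintype S] {K : Matrix S S ℝ}

/-- The set `C` is closed for the chain with transition matrix `K`: the chain cannot leave it. -/
def IsAbsorbing (K : Matrix S S ℝ) (C : Set S) : Prop := ∀ s ∈ C, ∀ s' ∉ C, K s s' = 0

variable [DecidableEq S]

theorem exists_pow_succ_pos (hK : K ∈ rowStochastic ℝ S) {s x y : S}
    (hx : ∃ n, 0 < (K ^ n) s x) (hxy : K x y ≠ 0) : ∃ n, 0 < (K ^ n) s y := by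
  obtain ⟨n, hn⟩ := hx
  refine ⟨n + 1, ?_⟩
  rw [pow_succ, mul_apply]
  exact Finset.sum_pos' (fun z _ => mul_nonneg (nonneg_of_mem_rowStochastic (pow_mem hK n))
      (nonneg_of_mem_rowStochastic hK))
    ⟨x, Finset.mem_univ x, mul_pos hn ((nonneg_of_mem_rowStochastic hK).lt_of_ne' hxy)⟩

theorem IsAbsorbing.mem_of_pow_pos (hK : K ∈ rowStochastic ℝ S) {C : Set S}
    (hC : IsAbsorbing K C) {s x : S} (hs : s ∈ C) {n : ℕ} (hn : 0 < (K ^ n) s x) : x ∈ C := by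
  induction n generalizing x with
  | zero =>
    obtain rfl : s = x := by
      by_contra hne
      simp [one_apply_ne hne] at hn
    exact hs
  | succ n ih =>
    rw [pow_succ, mul_apply] at hn
    obtain ⟨y, -, hy⟩ := Finset.exists_ne_zero_of_sum_ne_zero hn.ne'
    have hpos : 0 < (K ^ n) s y :=
      (nonneg_of_mem_rowStochastic (pow_mem hK n)).lt_of_ne' (left_ne_zero_of_mul hy)
    by_contra hx
    exact right_ne_zero_of_mul hy (hC y (ih hpos) x hx)

theorem IsAbsorbing.exists_isRecurrentClass_subset (hK : K ∈ rowStochastic ℝ S) {D : Set S}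
    (hD : IsAbsorbing K D) (hne : D.Nonempty) : ∃ C ⊆ D, IsRecurrentClass K C := by
  obtain ⟨C, hCD, hC⟩ := (Set.toFinite {C : Set S | C.Nonempty ∧ IsAbsorbing K C}
    ).exists_le_minimal ⟨hne, hD⟩
  refine ⟨C, hCD, hC.prop.1, hC.prop.2, fun s hs => ?_⟩
  have hreach : {x | ∃ n, 0 < (K ^ n) s x} ⊆ C := fun x ⟨_, hn⟩ =>
    hC.prop.2.mem_of_pow_pos hK hs hn
  refine hC.2 ⟨⟨s, 0, by simp⟩, fun x hx y hy => ?_⟩ hreach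
  by_contra hxy
  exact hy (exists_pow_succ_pos hK hx hxy)

theorem apply_eq_zero_of_le_mulVec (hK : K ∈ rowStochastic ℝ S) {g : S → ℝ} {s s' : S}
    (hmax : ∀ x, g x ≤ g s) (hle : g s ≤ (K *ᵥ g) s) (hs' : g s' ≠ g s) : K s s' = 0 := by
  have hnonneg : ∀ x ∈ Finset.univ, 0 ≤ K s x * (g s - g x) := fun x _ =>
    mul_nonneg (nonneg_of_mem_rowStochastic hK) (sub_nonneg.2 (hmax x))
  have hsum : ∑ x, K s x * (g s - g x) = g s - (K *ᵥ g) s := by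
    simp only [mul_sub, Finset.sum_sub_distrib, ← Finset.sum_mul, sum_row_of_mem_rowStochastic hK,
      one_mul, mulVec, dotProduct]
  have hzero := (Finset.sum_eq_zero_iff_of_nonneg hnonneg).1
    (le_antisymm (by linarith) (Finset.sum_nonneg hnonneg)) s' (Finset.mem_univ s')
  exact (mul_eq_zero.1 hzero).resolve_right (sub_ne_zero.2 hs'.symm)

theorem IsUnichain.exists_const (hK : K ∈ rowStochastic ℝ S) (huni : IsUnichain K)
    {g : S → ℝ} (hsub : ∀ s, (∀ x, g x ≤ g s) → g s ≤ (K *ᵥ g) s)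
    (hsup : ∀ s, (∃ x, g s < g x) → (K *ᵥ g) s ≤ g s) : ∃ c, ∀ s, g s = c := by
  have ⟨_, ⟨s₀, _⟩, _⟩ := huni.exists
  have : Nonempty S := ⟨s₀⟩
  obtain ⟨t, ht⟩ := Finite.exists_max g
  obtain ⟨b, hb⟩ := Finite.exists_min g
  rcases (ht b).eq_or_lt with hbt | hbt
  · exact ⟨g t, fun s => le_antisymm (ht s) (hbt ▸ hb s)⟩
  have htop : IsAbsorbing K {s | g s = g t} := fun s hs s' hs' =>
    have hmax : ∀ x, g x ≤ g s := fun x => (ht x).trans_eq hs.symm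
    apply_eq_zero_of_le_mulVec hK hmax (hsub s hmax) (hs.symm ▸ hs')
  have hbot : IsAbsorbing K {s | g s = g b} := fun s hs s' hs' => by
    change g s = g b at hs
    change g s' ≠ g b at hs'
    refine apply_eq_zero_of_le_mulVec hK (g := -g) (fun x => neg_le_neg (hs ▸ hb x)) ?_ ?_
    · rw [mulVec_neg]
      exact neg_le_neg (hsup s ⟨t, hs ▸ hbt⟩)
    · simpa only [Pi.neg_apply, ne_eq, neg_inj, hs] using hs'
  obtain ⟨C, hCt, hC⟩ := htop.exists_isRecurrentClass_subset hK ⟨t, rfl⟩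
  obtain ⟨C', hCb, hC'⟩ := hbot.exists_isRecurrentClass_subset hK ⟨b, rfl⟩
  obtain ⟨s, hs⟩ := hC.1
  have hst : g s = g t := hCt hs
  have hsb : g s = g b := hCb (huni.unique hC hC' ▸ hs)
  exact absurd (hsb.symm.trans hst) hbt.ne

end RecurrentClass

section Execution

variable {S A : Type*} [Fintype S] [Fintype A] (M : FiniteMDP S A) (w : TemporalOption S A)

/-- The probability that, in state `s` under the policy of the option `w`, the next action, state
and reward are those listed in `z`. -/
def outcomeProb (s : S) (z : A × S × M.rewards) : ℝ := w.pi s z.1 * M.p s z.1 z.2.1 z.2.2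

theorem outcomeProb_nonneg (s : S) (z : A × S × M.rewards) : 0 ≤ outcomeProb M w s z :=
  mul_nonneg (w.pi_nonneg _ _) (M.p_nonneg _ _ _ _)

theorem sum_outcomeProb (s : S) : ∑ z, outcomeProb M w s z = 1 := by
  simp only [outcomeProb, Fintype.sum_prod_type, ← Finset.mul_sum, M.p_sum, mul_one, w.pi_sum]

theorem sum_fin_succ_fun {Z R : Type*} [Fintype Z] [AddCommMonoid R] (n : ℕ)
    (f : (Fin (n + 1) → Z) → R) :
    ∑ τ, f τ = ∑ z, ∑ τ : Fin n → Z, f (Fin.cons z τ) := by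
  rw [← Fintype.sum_prod_type']
  exact (Fintype.sum_equiv (Fin.consEquiv fun _ => Z) _ _ fun _ => rfl).symm

theorem sum_execProb_zero_mul (s : S) (G : (Fin 1 → A × S × M.rewards) → ℝ) :
    ∑ τ, execProb M w 0 s τ * G τ =
      ∑ z, outcomeProb M w s z * (w.beta z.2.1 * G fun _ => z) := by
  refine Fintype.sum_equiv (Equiv.funUnique (Fin 1) _) _ _ fun τ => ?_
  have hconst : (fun _ => τ 0) = τ := funext fun i => congrArg τ (Subsingleton.elim _ _)
  simp [execProb, outcomeProb, hconst, mul_assoc]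

theorem sum_execProb_succ_mul (l : ℕ) (s : S) (G : (Fin (l + 2) → A × S × M.rewards) → ℝ) :
    ∑ τ, execProb M w (l + 1) s τ * G τ =
      ∑ z, outcomeProb M w s z * ((1 - w.beta z.2.1) *
        ∑ τ, execProb M w l z.2.1 τ * G (Fin.cons z τ)) := by
  simp only [sum_fin_succ_fun (l + 1), execProb, outcomeProb, Fin.cons_zero, Fin.tail_cons,
    Finset.mul_sum, mul_assoc]

theorem execProb_nonneg (l : ℕ) (s : S) (τ : Fin (l + 1) → A × S × M.rewards) :
    0 ≤ execProb M w l s τ := by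
  induction l generalizing s with
  | zero => exact mul_nonneg (outcomeProb_nonneg M w _ _) (w.beta_nonneg _)
  | succ l ih =>
    exact mul_nonneg (mul_nonneg (outcomeProb_nonneg M w _ _) (sub_nonneg.2 (w.beta_le_one _)))
      (ih _ _)

theorem lengthProb_nonneg (s : S) (l : ℕ) : 0 ≤ lengthProb M w s l :=
  Finset.sum_nonneg fun _ _ => execProb_nonneg M w _ _ _

theorem lengthProb_zero (s : S) :
    lengthProb M w s 0 = ∑ z, outcomeProb M w s z * w.beta z.2.1 := by
  simpa only [lengthProb, mul_one] using sum_execProb_zero_mul M w s fun _ => 1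

theorem lengthProb_succ (s : S) (l : ℕ) :
    lengthProb M w s (l + 1) =
      ∑ z, outcomeProb M w s z * ((1 - w.beta z.2.1) * lengthProb M w z.2.1 l) := by
  simpa only [lengthProb, mul_one] using sum_execProb_succ_mul M w l s fun _ => 1

/-- The probability that the option `w`, initiated in `s`, has length more than `n`. -/
def survivalProb (n : ℕ) (s : S) : ℝ := 1 - ∑ l ∈ Finset.range n, lengthProb M w s l

theorem survivalProb_succ (n : ℕ) (s : S) :
    survivalProb M w (n + 1) s =
      ∑ z, outcomeProb M w s z * ((1 - w.beta z.2.1) * survivalProb M w n z.2.1) := by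
  simp only [survivalProb, Finset.sum_range_succ', lengthProb_zero, lengthProb_succ]
  rw [Finset.sum_comm]
  nth_rewrite 1 [← sum_outcomeProb M w s]
  simp only [← Finset.mul_sum, ← Finset.sum_add_distrib, ← Finset.sum_sub_distrib]
  exact Finset.sum_congr rfl fun z _ => by ring

theorem abs_le_mul_survivalProb {d : S → ℝ}
    (hd : ∀ s, d s = ∑ z, outcomeProb M w s z * ((1 - w.beta z.2.1) * d z.2.1)) (n : ℕ) (s : S) :
    |d s| ≤ ‖d‖ * survivalProb M w n s := by
  induction n generalizing s with
  | zero => simpa [survivalProb] using norm_le_pi_norm d s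
  | succ n ih =>
    rw [hd s, survivalProb_succ, Finset.mul_sum]
    refine (Finset.abs_sum_le_sum_abs _ _).trans (Finset.sum_le_sum fun z _ => ?_)
    have hβ := sub_nonneg.2 (w.beta_le_one z.2.1)
    have hp := outcomeProb_nonneg M w s z
    rw [abs_mul, abs_mul, abs_of_nonneg hp, abs_of_nonneg hβ, mul_left_comm ‖d‖,
      mul_left_comm ‖d‖]
    gcongr
    exact ih z.2.1

theorem eq_zero_of_killed_harmonic {s : S} (hterm : HasSum (lengthProb M w s) 1) {d : S → ℝ}
    (hd : ∀ s, d s = ∑ z, outcomeProb M w s z * ((1 - w.beta z.2.1) * d z.2.1)) : d s = 0 := by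
  have hlim : Tendsto (fun n => ‖d‖ * survivalProb M w n s) atTop (𝓝 (‖d‖ * (1 - 1))) :=
    (hterm.tendsto_sum_nat.const_sub 1).const_mul ‖d‖
  rw [sub_self, mul_zero] at hlim
  exact abs_nonpos_iff.1 (ge_of_tendsto' hlim fun n => abs_le_mul_survivalProb M w hd n s)

/-- The part of `execValue` that comes from executions of length `l + 1`. -/
def execValueAt (ρ : A × S × M.rewards → ℝ) (f : S → ℝ) (s : S) (l : ℕ) : ℝ :=
  ∑ τ, execProb M w l s τ * (∑ i, ρ (τ i) + f (τ (Fin.last l)).2.1)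

/-- The expectation, for the option `w` initiated in `s`, of the sum of the values of `ρ` along
the execution and of the value of `f` at the state of termination. -/
def execValue (ρ : A × S × M.rewards → ℝ) (f : S → ℝ) (s : S) : ℝ := ∑' l, execValueAt M w ρ f s l

theorem meanOptionReward_eq_execValue (s : S) :
    meanOptionReward M w s = execValue M w (fun z => z.2.2) 0 s := by
  simp only [meanOptionReward, execValue, execValueAt, Pi.zero_apply, add_zero]

theorem meanOptionLength_eq_execValue (s : S) :
    meanOptionLength M w s = execValue M w 1 0 s := by
  refine tsum_congr fun l => ?_
  simp [execValueAt, lengthProb, ← Finset.sum_mul, mul_comm]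

theorem termProb_eq_execValue [DecidableEq S] (s s' : S) :
    termProb M w s s' = execValue M w 0 (Pi.single s' 1) s := by
  simp only [termProb, execValue, execValueAt, Pi.single_apply, Pi.zero_apply,
    Finset.sum_const_zero, zero_add]

theorem execValueAt_zero (ρ : A × S × M.rewards → ℝ) (f : S → ℝ) (s : S) :
    execValueAt M w ρ f s 0 =
      ∑ z, outcomeProb M w s z * (w.beta z.2.1 * (ρ z + f z.2.1)) := by
  simp [execValueAt, sum_execProb_zero_mul]

theorem execValueAt_succ (ρ : A × S × M.rewards → ℝ) (f : S → ℝ) (s : S) (l : ℕ) :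
    execValueAt M w ρ f s (l + 1) = ∑ z, outcomeProb M w s z * ((1 - w.beta z.2.1) *
      (ρ z * lengthProb M w z.2.1 l + execValueAt M w ρ f z.2.1 l)) := by
  simp only [execValueAt, sum_execProb_succ_mul, lengthProb, Fin.sum_univ_succ (n := l + 1),
    Fin.cons_zero, Fin.cons_succ, ← Fin.succ_last, add_assoc, mul_add, Finset.sum_add_distrib,
    ← Finset.sum_mul, mul_comm (ρ _)]

theorem abs_execValueAt_le (ρ : A × S × M.rewards → ℝ) (f : S → ℝ) (s : S) (l : ℕ) :
    |execValueAt M w ρ f s l| ≤ (‖ρ‖ + ‖f‖) * ((l + 1) * lengthProb M w s l) := by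
  rw [execValueAt, lengthProb, Finset.mul_sum, Finset.mul_sum]
  refine (Finset.abs_sum_le_sum_abs _ _).trans (Finset.sum_le_sum fun τ _ => ?_)
  have hρ : |∑ i, ρ (τ i)| ≤ (l + 1) * ‖ρ‖ := by
    refine (Finset.abs_sum_le_sum_abs _ _).trans
      ((Finset.sum_le_sum fun i _ => norm_le_pi_norm ρ (τ i)).trans_eq ?_)
    simp
  have hf : |f (τ (Fin.last l)).2.1| ≤ (l + 1) * ‖f‖ :=
    (norm_le_pi_norm f _).trans (le_mul_of_one_le_left (norm_nonneg f) (by simp))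
  have hτ := execProb_nonneg M w l s τ
  calc |execProb M w l s τ * (∑ i, ρ (τ i) + f (τ (Fin.last l)).2.1)|
      = execProb M w l s τ * |∑ i, ρ (τ i) + f (τ (Fin.last l)).2.1| := by
        rw [abs_mul, abs_of_nonneg hτ]
    _ ≤ execProb M w l s τ * ((l + 1) * ‖ρ‖ + (l + 1) * ‖f‖) := by
        gcongr
        exact (abs_add_le _ _).trans (add_le_add hρ hf)
    _ = (‖ρ‖ + ‖f‖) * ((l + 1) * execProb M w l s τ) := by ring

variable {M w}

theorem FiniteMeanLength.hasSum_execValueAt {s : S} (hlen : FiniteMeanLength M w s)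
    (ρ : A × S × M.rewards → ℝ) (f : S → ℝ) :
    HasSum (execValueAt M w ρ f s) (execValue M w ρ f s) :=
  (Summable.of_norm_bounded (hlen.2.mul_left _) (abs_execValueAt_le M w ρ f s)).hasSum

theorem FiniteMeanLength.one_le_meanOptionLength {s : S} (hlen : FiniteMeanLength M w s) :
    1 ≤ meanOptionLength M w s := by
  rw [← hlen.1.tsum_eq]
  exact hlen.1.summable.tsum_le_tsum
    (fun l => le_mul_of_one_le_left (lengthProb_nonneg M w s l) (by simp)) hlen.2

variable (hlen : ∀ s, FiniteMeanLength M w s)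
include hlen

theorem execValue_eq_first_step (ρ : A × S × M.rewards → ℝ) (f : S → ℝ) (s : S) :
    execValue M w ρ f s = ∑ z, outcomeProb M w s z *
      (ρ z + ((1 - w.beta z.2.1) * execValue M w ρ f z.2.1 + w.beta z.2.1 * f z.2.1)) := by
  have hsucc : HasSum (fun l => execValueAt M w ρ f s (l + 1)) (∑ z, outcomeProb M w s z *
      ((1 - w.beta z.2.1) * (ρ z * 1 + execValue M w ρ f z.2.1))) := by
    simp only [execValueAt_succ]
    exact hasSum_sum fun z _ => ((((hlen z.2.1).1.mul_left _).add
      ((hlen z.2.1).hasSum_execValueAt ρ f)).mul_left _).mul_left _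
  rw [execValue, ((hlen s).hasSum_execValueAt ρ f).summable.tsum_eq_zero_add, hsucc.tsum_eq,
    execValueAt_zero, ← Finset.sum_add_distrib]
  exact Finset.sum_congr rfl fun z _ => by ring

theorem eq_execValue {ρ : A × S × M.rewards → ℝ} {f h : S → ℝ}
    (hh : ∀ s, h s = ∑ z, outcomeProb M w s z *
      (ρ z + ((1 - w.beta z.2.1) * h z.2.1 + w.beta z.2.1 * f z.2.1))) (s : S) :
    h s = execValue M w ρ f s := by
  refine sub_eq_zero.1 (eq_zero_of_killed_harmonic M w (d := h - execValue M w ρ f)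
    (hlen s).1 fun x => ?_)
  rw [Pi.sub_apply, hh x, execValue_eq_first_step hlen, ← Finset.sum_sub_distrib]
  exact Finset.sum_congr rfl fun z _ => by rw [Pi.sub_apply]; ring

theorem execValue_sub_const (ρ : A × S × M.rewards → ℝ) (c : ℝ) (s : S) :
    execValue M w (fun z => ρ z - c) 0 s = execValue M w ρ 0 s - c * meanOptionLength M w s := by
  have hterm : ∀ l, execValueAt M w (fun z => ρ z - c) 0 s l =
      execValueAt M w ρ 0 s l - c * execValueAt M w 1 0 s l := fun l => by
    simp only [execValueAt, Finset.mul_sum, ← Finset.sum_sub_distrib]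
    exact Finset.sum_congr rfl fun τ _ => by simp; ring
  rw [meanOptionLength_eq_execValue, execValue, tsum_congr hterm]
  exact (((hlen s).hasSum_execValueAt ρ 0).sub
    (((hlen s).hasSum_execValueAt 1 0).mul_left c)).tsum_eq

theorem execValue_eq_add_sum_termProb [DecidableEq S] (ρ : A × S × M.rewards → ℝ) (f : S → ℝ)
    (s : S) :
    execValue M w ρ f s = execValue M w ρ 0 s + ∑ s', termProb M w s s' * f s' := by
  have hterm : ∀ l, execValueAt M w ρ f s l =
      execValueAt M w ρ 0 s l + ∑ s', execValueAt M w 0 (Pi.single s' 1) s l * f s' := fun l => by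
    simp only [execValueAt, Finset.sum_mul]
    rw [Finset.sum_comm, ← Finset.sum_add_distrib]
    exact Finset.sum_congr rfl fun τ _ => by simp [Pi.single_apply, mul_add]
  simp only [termProb_eq_execValue]
  rw [execValue, tsum_congr hterm]
  exact (((hlen s).hasSum_execValueAt ρ 0).add (hasSum_sum (s := Finset.univ) fun s' _ =>
    ((hlen s).hasSum_execValueAt 0 (Pi.single s' 1)).mul_right (f s'))).tsum_eq

theorem eq_optionModel [DecidableEq S] {c : ℝ} {f h : S → ℝ}
    (hh : ∀ s, h s = ∑ z, outcomeProb M w s z *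
      (z.2.2 - c + ((1 - w.beta z.2.1) * h z.2.1 + w.beta z.2.1 * f z.2.1))) (s : S) :
    h s = meanOptionReward M w s - c * meanOptionLength M w s + ∑ s', termProb M w s s' * f s' := by
  rw [eq_execValue hlen (ρ := fun z => z.2.2 - c) hh, execValue_eq_add_sum_termProb hlen,
    execValue_sub_const hlen, meanOptionReward_eq_execValue]

theorem eq_sum_termProb [DecidableEq S] {f h : S → ℝ}
    (hh : ∀ s, h s = ∑ z, outcomeProb M w s z *
      ((1 - w.beta z.2.1) * h z.2.1 + w.beta z.2.1 * f z.2.1)) (s : S) :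
    h s = ∑ s', termProb M w s s' * f s' := by
  have hzero : execValue M w 0 0 s = 0 := by simp [execValue, execValueAt]
  rw [eq_execValue hlen (ρ := 0) (f := f) (h := h) (by simpa using hh),
    execValue_eq_add_sum_termProb hlen, hzero, zero_add]

theorem termProb_mem_rowStochastic [DecidableEq S] : of (termProb M w) ∈ rowStochastic ℝ S := by
  refine mem_rowStochastic_iff_sum.2 ⟨fun s s' => ?_, fun s => ?_⟩
  · exact tsum_nonneg fun l => Finset.sum_nonneg fun τ _ =>
      mul_nonneg (execProb_nonneg M w l s τ) (by positivity)
  · have hone := eq_sum_termProb hlen (f := 1) (h := 1) fun s => by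
      simp [sum_outcomeProb]
    simpa using (hone s).symm

end Execution

section IntraOption

variable {S A O : Type*} [Fintype S] [Fintype A] (M : FiniteMDP S A) (opt : O → TemporalOption S A)

theorem intraOptionEq_iff {u : S → O → ℝ} {c : ℝ} {q : S → O → ℝ} :
    IntraOptionEq M opt u c q ↔ ∀ s o, q s o =
      ∑ z, outcomeProb M (opt o) s z * (z.2.2 - c + u z.2.1 o) := by
  simp only [IntraOptionEq, outcomeProb, Fintype.sum_prod_type, Finset.mul_sum, mul_assoc]

theorem IntraOptionEq.add_const {u : S → O → ℝ} {c : ℝ} {q : S → O → ℝ}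
    (h : IntraOptionEq M opt u c q) (b : ℝ) :
    IntraOptionEq M opt (fun s o => u s o + b) c (fun s o => q s o + b) := by
  rw [intraOptionEq_iff] at h ⊢
  intro s o
  simp only [h s o, ← add_assoc, mul_add _ _ b, Finset.sum_add_distrib, ← Finset.sum_mul,
    sum_outcomeProb, one_mul]

/-- The expected reward of the next step when the option `x.2` is executed in the state `x.1`. -/
def stepReward (x : S × O) : ℝ := ∑ z, outcomeProb M (opt x.2) x.1 z * z.2.2

theorem intraOptionEq_iff_stepReward_eq {u : S → O → ℝ} {c : ℝ} {q : S → O → ℝ} :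
    IntraOptionEq M opt u c q ↔ stepReward M opt = c • 1 + (Function.uncurry q -
      fun x => ∑ z, outcomeProb M (opt x.2) x.1 z * u z.2.1 x.2) := by
  rw [intraOptionEq_iff, funext_iff, Prod.forall]
  refine forall₂_congr fun s o => ?_
  simp only [stepReward, mul_add, mul_sub, Finset.sum_add_distrib, Finset.sum_sub_distrib,
    ← Finset.sum_mul, sum_outcomeProb, one_mul, Pi.add_apply, Pi.sub_apply, Pi.smul_apply,
    Pi.one_apply, smul_eq_mul, mul_one, Function.uncurry]
  constructor <;> intro h <;> linarith

variable [Fintype O] (μ : Policy S O)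

omit [Fintype S] in
theorem uEval_add_const (q : S → O → ℝ) (c : ℝ) :
    uEval opt μ (fun s o => q s o + c) = fun s o => uEval opt μ q s o + c := by
  funext s o
  simp only [uEval, mul_add, Finset.sum_add_distrib, ← Finset.sum_mul, μ.prob_sum]
  ring

omit [Fintype S] in
theorem uEval_const (c : ℝ) (s : S) (o : O) : uEval opt μ (fun _ _ => c) s o = c := by
  simpa [uEval] using congrFun₂ (uEval_add_const opt μ 0 c) s o

theorem EvaluationEq.add_const {c : ℝ} {q : S → O → ℝ} (hq : EvaluationEq M opt μ c q) (b : ℝ) :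
    EvaluationEq M opt μ c (fun s o => q s o + b) := by
  rw [EvaluationEq, uEval_add_const]
  exact IntraOptionEq.add_const M opt hq b

variable [DecidableEq O]

theorem stepProb_nonneg (s : S) (o : O) (z : A × S × M.rewards × O) :
    0 ≤ stepProb M opt μ s o z := by
  have hβ := sub_nonneg.2 ((opt o).beta_le_one z.2.1)
  refine mul_nonneg (outcomeProb_nonneg M (opt o) s (z.1, z.2.1, z.2.2.1)) (add_nonneg ?_ ?_)
  · exact mul_nonneg ((opt o).beta_nonneg _) (μ.prob_nonneg _ _)
  · positivity

theorem sum_stepProb_mul (s : S) (o : O) (G : A × S × M.rewards × O → ℝ) :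
    ∑ z, stepProb M opt μ s o z * G z = ∑ y, outcomeProb M (opt o) s y *
      uEval opt μ (fun _ o' => G (y.1, y.2.1, y.2.2, o')) y.2.1 o := by
  simp only [Fintype.sum_prod_type, stepProb, outcomeProb, uEval, mul_assoc, add_mul,
    Finset.sum_add_distrib, mul_add, ← Finset.mul_sum, ite_mul, one_mul, zero_mul,
    Finset.sum_ite_eq', Finset.mem_univ, if_true]
  exact add_comm _ _

/-- The transition matrix of the pair (state, option being executed) from one time step to the
next. -/
def intraStep : Matrix (S × O) (S × O) ℝ :=
  fun x y => ∑ a, ∑ r, stepProb M opt μ x.1 x.2 (a, y.1, r, y.2)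

theorem sum_stepProb_mul_next (x : S × O) (g : S × O → ℝ) :
    ∑ z, stepProb M opt μ x.1 x.2 z * g (z.2.1, z.2.2.2) = (intraStep M opt μ *ᵥ g) x := by
  simp only [mulVec, dotProduct, intraStep, Fintype.sum_prod_type, Finset.sum_mul]
  rw [Finset.sum_comm]
  refine Finset.sum_congr rfl fun s' _ => ?_
  rw [Finset.sum_comm (s := (Finset.univ : Finset O))]
  exact Finset.sum_congr rfl fun a _ => Finset.sum_comm

theorem intraStep_mulVec (g : S × O → ℝ) (x : S × O) :
    (intraStep M opt μ *ᵥ g) x =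
      ∑ z, outcomeProb M (opt x.2) x.1 z * uEval opt μ (Function.curry g) z.2.1 x.2 := by
  rw [← sum_stepProb_mul_next, sum_stepProb_mul]
  rfl

theorem intraStep_mem_rowStochastic [DecidableEq S] :
    intraStep M opt μ ∈ rowStochastic ℝ (S × O) := by
  refine ⟨fun x y => Finset.sum_nonneg fun a _ => Finset.sum_nonneg fun r _ =>
    stepProb_nonneg M opt μ _ _ _, funext fun x => ?_⟩
  have hone : Function.curry (1 : S × O → ℝ) = fun _ _ => 1 := rfl
  simp only [intraStep_mulVec, hone, uEval_const, mul_one, sum_outcomeProb, Pi.one_apply]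

theorem evaluationEq_iff {c : ℝ} {q : S → O → ℝ} :
    EvaluationEq M opt μ c q ↔ stepReward M opt =
      c • 1 + (Function.uncurry q - intraStep M opt μ *ᵥ Function.uncurry q) := by
  have hstep : intraStep M opt μ *ᵥ Function.uncurry q =
      fun x => ∑ z, outcomeProb M (opt x.2) x.1 z * uEval opt μ q z.2.1 x.2 :=
    funext (intraStep_mulVec M opt μ (Function.uncurry q))
  rw [EvaluationEq, intraOptionEq_iff_stepReward_eq, hstep]

theorem sum_trajProb (n : ℕ) (s : S) (o : O) : ∑ τ, trajProb M opt μ n s o τ = 1 := by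
  induction n generalizing s o with
  | zero => simp [trajProb]
  | succ n ih =>
    simp only [sum_fin_succ_fun, trajProb, Fin.cons_zero, Fin.tail_cons, ← Finset.mul_sum, ih]
    rw [sum_stepProb_mul]
    simp only [uEval_const, mul_one, sum_outcomeProb]

theorem expectedReturn_succ (b : ℝ) (s : S) (o : O) (n : ℕ) :
    expectedReturn M opt μ b s o (n + 1) = stepReward M opt (s, o) - b +
      (intraStep M opt μ *ᵥ fun x => expectedReturn M opt μ b x.1 x.2 n) (s, o) := by
  have hcons : expectedReturn M opt μ b s o (n + 1) = ∑ z, stepProb M opt μ s o z *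
      (expectedReturn M opt μ b z.2.1 z.2.2.2 n + (z.2.2.1 - b)) := by
    simp only [expectedReturn, sum_fin_succ_fun, trajProb, Fin.cons_zero, Fin.tail_cons,
      Fin.sum_univ_succ, Fin.cons_succ, mul_add, Finset.sum_add_distrib, mul_assoc,
      ← Finset.mul_sum, ← Finset.sum_mul, sum_trajProb, one_mul]
    exact add_comm _ _
  rw [hcons, sum_stepProb_mul, intraStep_mulVec]
  simp only [uEval_add_const opt μ (fun _ _ => _), stepReward, mul_add, mul_sub,
    Finset.sum_add_distrib, Finset.sum_sub_distrib, ← Finset.sum_mul, sum_outcomeProb, one_mul]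
  exact add_comm _ _

theorem expectedReturn_eq_sum [DecidableEq S] (b : ℝ) (x : S × O) (n : ℕ) :
    expectedReturn M opt μ b x.1 x.2 n =
      (∑ i ∈ Finset.range n, intraStep M opt μ ^ i *ᵥ (stepReward M opt - b • 1)) x := by
  induction n generalizing x with
  | zero => simp [expectedReturn]
  | succ n ih =>
    rw [expectedReturn_succ, funext ih, Finset.sum_range_succ', mulVec_sum]
    simp [pow_succ', add_comm]

end IntraOption

section RewardRate

variable {S A O : Type*} [Fintype S] [Fintype A] [Fintype O] [DecidableEq S]
  {M : FiniteMDP S A} {opt : O → TemporalOption S A} {μ : Policy S O}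

theorem decisionChain_mulVec (g : S × O → ℝ) (x : S × O) :
    (decisionChain M opt μ *ᵥ g) x =
      ∑ s', termProb M (opt x.2) x.1 s' * ∑ o', μ.prob s' o' * g (s', o') := by
  simp only [mulVec, dotProduct, decisionChain, Fintype.sum_prod_type, Finset.mul_sum, mul_assoc]

section FiniteLength

variable (hlen : ∀ s o, FiniteMeanLength M (opt o) s)
include hlen

theorem inducedChain_mem_rowStochastic : inducedChain M opt μ ∈ rowStochastic ℝ S := by
  have hstoch := fun o => mem_rowStochastic_iff_sum.1 (termProb_mem_rowStochastic fun s => hlen s o)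
  refine mem_rowStochastic_iff_sum.2 ⟨fun s s' => Finset.sum_nonneg fun o _ =>
    mul_nonneg (μ.prob_nonneg s o) ((hstoch o).1 s s'), fun s => ?_⟩
  have hrow : ∀ o, ∑ s', termProb M (opt o) s s' = 1 := fun o => (hstoch o).2 s
  simp only [inducedChain]
  rw [Finset.sum_comm]
  simp only [← Finset.mul_sum, hrow, mul_one, μ.prob_sum]

theorem decisionChain_mem_rowStochastic [DecidableEq O] :
    decisionChain M opt μ ∈ rowStochastic ℝ (S × O) := by
  have hstoch := fun o => mem_rowStochastic_iff_sum.1 (termProb_mem_rowStochastic fun s => hlen s o)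
  have hrow : ∀ s o, ∑ s', termProb M (opt o) s s' = 1 := fun s o => (hstoch o).2 s
  refine ⟨fun x y => mul_nonneg ((hstoch x.2).1 _ _) (μ.prob_nonneg _ _), funext fun x => ?_⟩
  simp only [decisionChain_mulVec, Pi.one_apply, mul_one, μ.prob_sum, hrow]

theorem EvaluationEq.meanOptionReward_eq {c : ℝ} {q : S → O → ℝ}
    (hq : EvaluationEq M opt μ c q) :
    (fun x : S × O => meanOptionReward M (opt x.2) x.1) =
      c • (fun x => meanOptionLength M (opt x.2) x.1) +
        (Function.uncurry q - decisionChain M opt μ *ᵥ Function.uncurry q) := by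
  rw [EvaluationEq, intraOptionEq_iff] at hq
  funext ⟨s, o⟩
  have hmodel := eq_optionModel (fun s => hlen s o) (h := fun s => q s o)
    (f := fun s' => ∑ o', μ.prob s' o' * q s' o') (fun s => hq s o) s
  simp only [Pi.add_apply, Pi.sub_apply, Pi.smul_apply, smul_eq_mul, decisionChain_mulVec,
    Function.uncurry]
  linarith

variable [DecidableEq O]

theorem EvaluationEq.tendsto_optionRatio {c : ℝ} {q : S → O → ℝ}
    (hq : EvaluationEq M opt μ c q) (s : S) (o : O) :
    Tendsto (optionRatio M opt μ s o) atTop (𝓝 c) :=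
  (tendsto_sum_pow_mulVec_div (decisionChain_mem_rowStochastic hlen)
    (fun x => one_pos.trans_le (hlen x.1 x.2).one_le_meanOptionLength)
    (hq.meanOptionReward_eq hlen) (s, o)).comp (tendsto_add_atTop_nat 1)

theorem EvaluationEq.rewardRate_eq [Nonempty S] [Nonempty O] {c : ℝ} {q : S → O → ℝ}
    (hq : EvaluationEq M opt μ c q) : rewardRate M opt μ = c :=
  (hq.tendsto_optionRatio hlen _ _).limUnder_eq

theorem exists_const_of_intraStep_mulVec_eq (huni : IsUnichain (inducedChain M opt μ))
    {h : S × O → ℝ} (hh : intraStep M opt μ *ᵥ h = h) : ∃ c : ℝ, h = c • 1 := by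
  let V : S → ℝ := fun s => ∑ o, μ.prob s o * h (s, o)
  have hterm : ∀ s o, h (s, o) = ∑ s', termProb M (opt o) s s' * V s' := fun s o =>
    eq_sum_termProb (fun s => hlen s o) (h := fun s => h (s, o)) (f := V)
      (fun s => (congrFun hh (s, o)).symm.trans (intraStep_mulVec M opt μ h (s, o))) s
  have hharm : ∀ s, (inducedChain M opt μ *ᵥ V) s = V s := fun s => by
    calc (inducedChain M opt μ *ᵥ V) s
        = ∑ o, μ.prob s o * ∑ s', termProb M (opt o) s s' * V s' := by
          simp only [mulVec, dotProduct, inducedChain, Finset.sum_mul, Finset.mul_sum, mul_assoc]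
          exact Finset.sum_comm
      _ = V s := by simp only [← hterm, V]
  obtain ⟨c, hc⟩ := huni.exists_const (inducedChain_mem_rowStochastic hlen)
    (fun s _ => (hharm s).ge) (fun s _ => (hharm s).le)
  refine ⟨c, funext fun x => ?_⟩
  have hrow := sum_row_of_mem_rowStochastic
    (termProb_mem_rowStochastic fun s => hlen s x.2) x.1
  simp only [of_apply] at hrow
  rw [hterm x.1 x.2]
  simp only [hc, ← Finset.sum_mul, hrow, Pi.smul_apply, Pi.one_apply, smul_eq_mul, one_mul, mul_one]

omit [DecidableEq O] in
theorem exists_evaluationEq [Nonempty S] [Nonempty O] (huni : IsUnichain (inducedChain M opt μ)) :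
    ∃ (c : ℝ) (q : S → O → ℝ), EvaluationEq M opt μ c q := by
  classical
  obtain ⟨c, q, hq⟩ := exists_poisson_solution (intraStep_mem_rowStochastic M opt μ)
    (fun _ => exists_const_of_intraStep_mulVec_eq hlen huni) (stepReward M opt)
  exact ⟨c, Function.curry q, (evaluationEq_iff M opt μ).2 (by rwa [Function.uncurry_curry])⟩

end FiniteLength

section StepProcess

variable [DecidableEq O] {c : ℝ} {q : S → O → ℝ} (hq : EvaluationEq M opt μ c q)
include hq

omit [DecidableEq S] in
theorem EvaluationEq.tendsto_expectedReturn_div (s : S) (o : O) :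
    Tendsto (fun t : ℕ => expectedReturn M opt μ 0 s o t / t) atTop (𝓝 c) := by
  classical
  have hlim := tendsto_sum_pow_mulVec_div_natCast (intraStep_mem_rowStochastic M opt μ)
    ((evaluationEq_iff M opt μ).1 hq) (s, o)
  refine hlim.congr fun t => ?_
  rw [expectedReturn_eq_sum M opt μ 0 (s, o), zero_smul, sub_zero, Finset.sum_apply]

theorem EvaluationEq.expectedReturn_eq (x : S × O) (n : ℕ) :
    expectedReturn M opt μ c x.1 x.2 n = Function.uncurry q x -
      (intraStep M opt μ ^ n *ᵥ Function.uncurry q) x := by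
  rw [expectedReturn_eq_sum, (evaluationEq_iff M opt μ).1 hq, add_sub_cancel_left,
    sum_range_pow_mulVec_sub, Pi.sub_apply]

end StepProcess

section DiffValue

variable [DecidableEq O] [Nonempty S] [Nonempty O] (hlen : ∀ s o, FiniteMeanLength M (opt o) s)
  (huni : IsUnichain (inducedChain M opt μ))
include hlen huni

theorem EvaluationEq.exists_tendsto_cesaroReturn {c : ℝ} {q : S → O → ℝ}
    (hq : EvaluationEq M opt μ c q) :
    ∃ b, ∀ s o, Tendsto (cesaroReturn M opt μ s o) atTop (𝓝 (q s o - b)) := by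
  have hP := intraStep_mem_rowStochastic M opt μ
  let P := intraStep M opt μ
  obtain ⟨b, h, hbh⟩ := exists_poisson_solution hP
    (fun _ => exists_const_of_intraStep_mulVec_eq hlen huni) (Function.uncurry q)
  have hPq : P *ᵥ Function.uncurry q = b • 1 + (P *ᵥ h - P *ᵥ (P *ᵥ h)) := by
    rw [hbh, mulVec_add, mulVec_smul_one hP, mulVec_sub]
  refine ⟨b, fun s o => ?_⟩
  have hmean := tendsto_sum_pow_mulVec_div_natCast hP hPq (s, o)
  refine (hmean.const_sub (q s o)).congr' ?_
  filter_upwards [eventually_gt_atTop 0] with N hN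
  have hpow : ∑ n ∈ Finset.Icc 1 N, (P ^ n *ᵥ Function.uncurry q) (s, o) =
      ∑ i ∈ Finset.range N, (P ^ i *ᵥ (P *ᵥ Function.uncurry q)) (s, o) := by
    rw [Finset.range_eq_Ico]
    simp only [mulVec_mulVec, ← pow_succ]
    exact (Finset.sum_Ico_add' (fun n => (P ^ n *ᵥ Function.uncurry q) (s, o)) 0 N 1).symm
  have hsum : ∑ n ∈ Finset.Icc 1 N, expectedReturn M opt μ (rewardRate M opt μ) s o n =
      N * q s o - ∑ i ∈ Finset.range N, (P ^ i *ᵥ (P *ᵥ Function.uncurry q)) (s, o) := by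
    simp only [hq.rewardRate_eq hlen, hq.expectedReturn_eq (s, o), Finset.sum_sub_distrib, ← hpow,
      Finset.sum_const, Nat.card_Icc, Nat.add_sub_cancel, nsmul_eq_mul, Function.uncurry_apply_pair,
      P]
  have hN0 : (N : ℝ) ≠ 0 := Nat.cast_ne_zero.2 hN.ne'
  rw [cesaroReturn, hsum, sub_div, mul_div_cancel_left₀ _ hN0]

theorem EvaluationEq.exists_diffValue_eq {c : ℝ} {q : S → O → ℝ} (hq : EvaluationEq M opt μ c q) :
    ∃ b, ∀ s o, diffValue M opt μ s o = q s o - b := by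
  obtain ⟨b, hb⟩ := hq.exists_tendsto_cesaroReturn hlen huni
  exact ⟨b, fun s o => (hb s o).limUnder_eq⟩

theorem evaluationEq_diffValue :
    EvaluationEq M opt μ (rewardRate M opt μ) (diffValue M opt μ) := by
  obtain ⟨c, q, hq⟩ := exists_evaluationEq hlen huni
  obtain ⟨b, hb⟩ := hq.exists_diffValue_eq hlen huni
  have hshift : diffValue M opt μ = fun s o => q s o + -b := funext₂ hb
  rw [hshift, hq.rewardRate_eq hlen]
  exact hq.add_const M opt μ (-b)

theorem tendsto_cesaroReturn (s : S) (o : O) :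
    Tendsto (cesaroReturn M opt μ s o) atTop (𝓝 (diffValue M opt μ s o)) := by
  obtain ⟨c, q, hq⟩ := exists_evaluationEq hlen huni
  obtain ⟨b, hb⟩ := hq.exists_tendsto_cesaroReturn hlen huni
  exact tendsto_nhds_limUnder ⟨_, hb s o⟩

theorem setOf_evaluationEq_eq :
    {q : S → O → ℝ | ∃ c, EvaluationEq M opt μ c q} =
      {q : S → O → ℝ | ∃ b, ∀ s o, q s o = diffValue M opt μ s o + b} := by
  ext q
  refine ⟨fun ⟨c, hq⟩ => ?_, fun ⟨b, hb⟩ => ?_⟩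
  · obtain ⟨b, hb⟩ := hq.exists_diffValue_eq hlen huni
    exact ⟨b, fun s o => by rw [hb, sub_add_cancel]⟩
  · rw [show q = fun s o => diffValue M opt μ s o + b from funext₂ hb]
    exact ⟨_, (evaluationEq_diffValue hlen huni).add_const M opt μ b⟩

end DiffValue

end RewardRate

section Greedy

variable {S A O : Type*} [Fintype O]

section MaxValue

variable [Nonempty O]

/-- The value `max_o q(s, o)` of a state under option values `q`, as it enters `uOpt`. -/
def maxValue (q : S → O → ℝ) (s : S) : ℝ :=
  Finset.univ.sup' Finset.univ_nonempty fun o => q s o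

theorem le_maxValue (q : S → O → ℝ) (s : S) (o : O) : q s o ≤ maxValue q s :=
  Finset.le_sup' (fun o => q s o) (Finset.mem_univ o)

theorem exists_forall_eq_maxValue (q : S → O → ℝ) : ∃ δ : S → O, ∀ s, q s (δ s) = maxValue q s := by
  choose δ _ hδ using fun s =>
    Finset.exists_mem_eq_sup' (Finset.univ_nonempty (α := O)) fun o => q s o
  exact ⟨δ, fun s => (hδ s).symm⟩

theorem maxValue_mono : Monotone (maxValue : (S → O → ℝ) → S → ℝ) := fun _ _ h s =>
  Finset.sup'_mono_fun fun o _ => h s o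

theorem maxValue_add_const (q : S → O → ℝ) (c : ℝ) (s : S) :
    maxValue (fun s o => q s o + c) s = maxValue q s + c := by
  refine le_antisymm (Finset.sup'_le _ _ fun o _ => add_le_add_left (le_maxValue q s o) c) ?_
  obtain ⟨δ, hδ⟩ := exists_forall_eq_maxValue q
  exact hδ s ▸ le_maxValue (fun s o => q s o + c) s (δ s)

theorem sum_prob_mul_le_maxValue (μ : Policy S O) (q : S → O → ℝ) (s : S) :
    ∑ o, μ.prob s o * q s o ≤ maxValue q s := by
  calc ∑ o, μ.prob s o * q s o ≤ ∑ o, μ.prob s o * maxValue q s := by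
        gcongr with o
        · exact μ.prob_nonneg s o
        · exact le_maxValue q s o
    _ = maxValue q s := by rw [← Finset.sum_mul, μ.prob_sum, one_mul]

theorem IsGreedy.sum_prob_mul_eq {μ : Policy S O} {q : S → O → ℝ} (hμ : IsGreedy μ q) (s : S) :
    ∑ o, μ.prob s o * q s o = maxValue q s := by
  have hterm : ∀ o, μ.prob s o * q s o = μ.prob s o * maxValue q s := fun o => by
    rcases (μ.prob_nonneg s o).eq_or_lt with hzero | hpos
    · rw [← hzero, zero_mul, zero_mul]
    · rw [(le_maxValue q s o).antisymm (Finset.sup'_le _ _ fun o' _ => hμ s o hpos o')]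
  rw [Finset.sum_congr rfl fun o _ => hterm o, ← Finset.sum_mul, μ.prob_sum, one_mul]

end MaxValue

variable [DecidableEq O]

/-- The policy that initiates the option `δ s` in the state `s`. -/
def Policy.deterministic (δ : S → O) : Policy S O where
  prob s := Pi.single (δ s) 1
  prob_nonneg _ o := Pi.single_nonneg (α := fun _ : O => ℝ).2 zero_le_one o
  prob_sum s := Finset.univ.sum_pi_single' (δ s) 1 |>.trans (if_pos (Finset.mem_univ _))

theorem Policy.isGreedy_deterministic [Nonempty O] {q : S → O → ℝ} {δ : S → O}
    (hδ : ∀ s, q s (δ s) = maxValue q s) : IsGreedy (Policy.deterministic δ) q := by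
  intro s o ho o'
  have hoδ : o = δ s := by
    by_contra hne
    exact ho.ne' (Pi.single_eq_of_ne (M := fun _ => ℝ) hne 1)
  rw [hoδ, hδ s]
  exact le_maxValue q s o'

theorem inducedChain_deterministic_mulVec [Fintype S] [Fintype A] [DecidableEq S]
    (M : FiniteMDP S A) (opt : O → TemporalOption S A) (δ : S → O) (g : S → ℝ) (s : S) :
    (inducedChain M opt (Policy.deterministic δ) *ᵥ g) s =
      ∑ s', termProb M (opt (δ s)) s s' * g s' := by
  simp only [mulVec, dotProduct, inducedChain, Policy.deterministic, Pi.single_apply, ite_mul,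
    one_mul, zero_mul, Finset.sum_ite_eq', Finset.mem_univ, if_true]

end Greedy

section Optimality

variable {S A O : Type*} [Fintype S] [Fintype A] [Fintype O] [Nonempty O]
  {M : FiniteMDP S A} {opt : O → TemporalOption S A}

section BellmanOperator

/-- The expectation of `uOpt` after one time step; the counterpart of `intraStep` with the next
option chosen greedily. -/
def optStep (M : FiniteMDP S A) (opt : O → TemporalOption S A) (q : S × O → ℝ) (x : S × O) : ℝ :=
  ∑ z, outcomeProb M (opt x.2) x.1 z * uOpt opt (Function.curry q) z.2.1 x.2

theorem optimalityEq_iff {c : ℝ} {q : S → O → ℝ} :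
    OptimalityEq M opt c q ↔ stepReward M opt =
      c • 1 + (Function.uncurry q - optStep M opt (Function.uncurry q)) :=
  intraOptionEq_iff_stepReward_eq M opt

theorem optStep_mono : Monotone (optStep M opt) := fun q₁ q₂ h x => by
  refine Finset.sum_le_sum fun z _ => mul_le_mul_of_nonneg_left ?_ (outcomeProb_nonneg M _ _ z)
  have hcont := sub_nonneg.2 ((opt x.2).beta_le_one z.2.1)
  have hterm := (opt x.2).beta_nonneg z.2.1
  exact add_le_add (mul_le_mul_of_nonneg_left (h _) hcont)
    (mul_le_mul_of_nonneg_left (maxValue_mono (fun s o => h (s, o)) _) hterm)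

omit [Fintype S] in
theorem uOpt_add_const (q : S → O → ℝ) (c : ℝ) (s : S) (o : O) :
    uOpt opt (fun s o => q s o + c) s o = uOpt opt q s o + c := by
  change (1 - (opt o).beta s) * (q s o + c) + (opt o).beta s * maxValue (fun s o => q s o + c) s =
    (1 - (opt o).beta s) * q s o + (opt o).beta s * maxValue q s + c
  rw [maxValue_add_const]
  ring

theorem optStep_add_smul_one (q : S × O → ℝ) (c : ℝ) :
    optStep M opt (q + c • 1) = optStep M opt q + c • 1 := by
  have hcurry : Function.curry (q + c • 1) = fun s o => Function.curry q s o + c := by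
    funext s o
    simp [Function.curry]
  funext x
  simp only [optStep, hcurry, uOpt_add_const, mul_add, Finset.sum_add_distrib, ← Finset.sum_mul,
    sum_outcomeProb, Pi.add_apply, Pi.smul_apply, Pi.one_apply, smul_eq_mul, mul_one, one_mul]

theorem continuous_optStep : Continuous (optStep M opt) := by
  unfold optStep uOpt Function.curry
  refine continuous_pi fun x => continuous_finsetSum _ fun z _ => ?_
  have : Continuous fun q : S × O → ℝ =>
      Finset.univ.sup' Finset.univ_nonempty fun o' => q (z.2.1, o') :=
    Continuous.finset_sup'_apply _ fun o' _ => continuous_apply _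
  fun_prop

theorem OptimalityEq.add_const {c : ℝ} {q : S → O → ℝ} (hq : OptimalityEq M opt c q) (b : ℝ) :
    OptimalityEq M opt c (fun s o => q s o + b) := by
  rw [OptimalityEq, show uOpt opt (fun s o => q s o + b) = fun s o => uOpt opt q s o + b from
    funext₂ (uOpt_add_const q b)]
  exact IntraOptionEq.add_const M opt hq b

omit [Fintype S] in
theorem IsGreedy.uEval_eq_uOpt {μ : Policy S O} {q : S → O → ℝ} (hμ : IsGreedy μ q) :
    uEval opt μ q = uOpt opt q := by
  funext s o
  rw [uEval, hμ.sum_prob_mul_eq]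
  rfl

theorem OptimalityEq.evaluationEq {c : ℝ} {q : S → O → ℝ} (hq : OptimalityEq M opt c q)
    {μ : Policy S O} (hμ : IsGreedy μ q) : EvaluationEq M opt μ c q := by
  rwa [EvaluationEq, hμ.uEval_eq_uOpt]

theorem contractingWith_discounted_optStep {γ : NNReal} (hγ : γ < 1) :
    ContractingWith γ fun q => stepReward M opt + γ • optStep M opt q := by
  refine contractingWith_of_monotone_of_map_add_smul_one_le hγ (fun q₁ q₂ h => ?_) fun q c _ => ?_
  · exact add_le_add_right (smul_le_smul_of_nonneg_left (optStep_mono h) γ.2) _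
  · rw [optStep_add_smul_one, smul_add, ← add_assoc, ← smul_smul]
    exact le_rfl

variable [DecidableEq O]

theorem intraStep_mulVec_le_optStep (μ : Policy S O) (q : S × O → ℝ) :
    intraStep M opt μ *ᵥ q ≤ optStep M opt q := fun x => by
  rw [intraStep_mulVec]
  refine Finset.sum_le_sum fun z _ => mul_le_mul_of_nonneg_left ?_ (outcomeProb_nonneg M _ _ z)
  exact add_le_add_right (mul_le_mul_of_nonneg_left (sum_prob_mul_le_maxValue μ _ _)
    ((opt x.2).beta_nonneg _)) _

theorem IsGreedy.intraStep_mulVec_eq {μ : Policy S O} {q : S × O → ℝ}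
    (hμ : IsGreedy μ (Function.curry q)) : intraStep M opt μ *ᵥ q = optStep M opt q := by
  funext x
  simp only [intraStep_mulVec, optStep, hμ.uEval_eq_uOpt]

end BellmanOperator

section Existence

variable [DecidableEq O]

theorem exists_discounted_solution {r : (S → O) → ℝ} {v : (S → O) → S → O → ℝ}
    (hv : ∀ δ, EvaluationEq M opt (Policy.deterministic δ) (r δ) (v δ)) {γ : ℝ} (hγ0 : 0 ≤ γ)
    (hγ1 : γ < 1) : ∃ δ w, ‖w‖ ≤ 2 * ‖Function.uncurry (v δ)‖ ∧
      stepReward M opt + γ • optStep M opt w = r δ • 1 + w := by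
  classical
  lift γ to NNReal using hγ0
  have hcontr := contractingWith_discounted_optStep (M := M) (opt := opt) hγ1
  let w := ContractingWith.fixedPoint _ hcontr
  have hw : stepReward M opt + γ • optStep M opt w = w := hcontr.fixedPoint_isFixedPt
  obtain ⟨δ, hδ⟩ := exists_forall_eq_maxValue (Function.curry w)
  -- The shift turns the reward `R` of the discounted equation into `R - r δ`, for which the
  -- undiscounted equation of the policy `δ` has the solution `v δ`.
  let b := -(r δ / (1 - γ))
  have hshift : stepReward M opt + γ • optStep M opt (w + b • 1) = r δ • 1 + (w + b • 1) := by
    have hb : γ * b = r δ + b := by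
      have hγ : (1 : ℝ) - γ ≠ 0 := (sub_pos.2 hγ1).ne'
      simp only [b]
      field_simp
      ring
    rw [optStep_add_smul_one, smul_add, ← add_assoc, hw, NNReal.smul_def, smul_smul, hb, add_smul]
    abel
  have hP := intraStep_mem_rowStochastic M opt (Policy.deterministic δ)
  have hgreedy : intraStep M opt (Policy.deterministic δ) *ᵥ (w + b • 1) =
      optStep M opt (w + b • 1) := by
    rw [mulVec_add, mulVec_smul_one hP, optStep_add_smul_one,
      (Policy.isGreedy_deterministic hδ).intraStep_mulVec_eq]
  refine ⟨δ, w + b • 1, ?_, hshift⟩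
  refine norm_discounted_le_two_mul (R := stepReward M opt - r δ • 1) hP γ.2 hγ1 ?_ ?_
  · rw [(evaluationEq_iff M opt _).1 (hv δ)]
    abel
  · rw [hgreedy, eq_comm, sub_add_eq_add_sub, sub_eq_iff_eq_add']
    exact hshift

theorem exists_optimalityEq {r : (S → O) → ℝ} {v : (S → O) → S → O → ℝ}
    (hv : ∀ δ, EvaluationEq M opt (Policy.deterministic δ) (r δ) (v δ)) :
    ∃ (c : ℝ) (q : S → O → ℝ), OptimalityEq M opt c q := by
  let E : (S → O) → Set (ℝ × (S × O → ℝ)) := fun δ =>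
    Set.Icc 0 1 ×ˢ Metric.closedBall 0 (2 * ‖Function.uncurry (v δ)‖) ∩
      {y | stepReward M opt + y.1 • optStep M opt y.2 = r δ • 1 + y.2}
  have hcompact : ∀ δ, IsCompact (E δ) := fun δ =>
    (isCompact_Icc.prod (isCompact_closedBall _ _)).inter_right <|
      isClosed_eq (continuous_const.add
        (continuous_fst.smul (continuous_optStep.comp continuous_snd)))
        (continuous_const.add continuous_snd)
  have hclosed : IsClosed (⋃ δ, Prod.fst '' E δ) := isClosed_iUnion_of_finite fun δ =>
    ((hcompact δ).image continuous_fst).isClosed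
  have hsub : Set.Ico 0 1 ⊆ ⋃ δ, Prod.fst '' E δ := fun γ hγ => by
    obtain ⟨δ, w, hnorm, hw⟩ := exists_discounted_solution hv hγ.1 hγ.2
    exact Set.mem_iUnion.2
      ⟨δ, (γ, w), ⟨⟨Set.Ico_subset_Icc_self hγ, mem_closedBall_zero_iff.2 hnorm⟩, hw⟩, rfl⟩
  have hone : (1 : ℝ) ∈ ⋃ δ, Prod.fst '' E δ := closure_minimal hsub hclosed <| by
    rw [closure_Ico zero_ne_one]
    exact Set.right_mem_Icc.2 zero_le_one
  obtain ⟨δ, ⟨_, w⟩, ⟨-, hw⟩, rfl⟩ := Set.mem_iUnion.1 hone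
  refine ⟨r δ, Function.curry w, optimalityEq_iff.2 ?_⟩
  rw [Function.uncurry_curry, ← add_sub_assoc]
  exact eq_sub_of_add_eq (by simpa using hw)

end Existence

section Rates

variable {c : ℝ} {q : S → O → ℝ} (hq : OptimalityEq M opt c q)
include hq

theorem OptimalityEq.le_of_evaluationEq [Nonempty S] {μ : Policy S O} {r : ℝ} {v : S → O → ℝ}
    (hv : EvaluationEq M opt μ r v) : r ≤ c := by
  classical
  rw [evaluationEq_iff] at hv
  rw [optimalityEq_iff] at hq
  rw [← sub_nonpos]
  refine nonpos_of_add_mulVec_le (intraStep_mem_rowStochastic M opt μ)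
    (d := Function.uncurry q - Function.uncurry v) fun x => ?_
  have hle := intraStep_mulVec_le_optStep (M := M) (opt := opt) μ (Function.uncurry q) x
  have hx := congrFun (hv.symm.trans hq) x
  simp only [Pi.add_apply, Pi.sub_apply, Pi.smul_apply, Pi.one_apply, smul_eq_mul, mul_one,
    mulVec_sub] at hx ⊢
  linarith

variable [Nonempty S] [DecidableEq S] [DecidableEq O]
  (hlen : ∀ s o, FiniteMeanLength M (opt o) s)
include hlen

theorem OptimalityEq.rewardRate_eq {μ : Policy S O} (hμ : IsGreedy μ q) :
    rewardRate M opt μ = c :=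
  (hq.evaluationEq hμ).rewardRate_eq hlen

variable (huni : ∀ μ : Policy S O, IsUnichain (inducedChain M opt μ))
include huni

theorem OptimalityEq.isGreatest_range_rewardRate :
    IsGreatest (Set.range fun μ : Policy S O => rewardRate M opt μ) c := by
  obtain ⟨δ, hδ⟩ := exists_forall_eq_maxValue q
  refine ⟨⟨_, hq.rewardRate_eq hlen (Policy.isGreedy_deterministic hδ)⟩, ?_⟩
  rintro _ ⟨μ, rfl⟩
  exact hq.le_of_evaluationEq (evaluationEq_diffValue hlen (huni μ))

theorem OptimalityEq.optimalRate_eq : optimalRate M opt = c :=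
  (hq.isGreatest_range_rewardRate hlen huni).csSup_eq

end Rates

section Uniqueness

variable [DecidableEq S]
  (hlen : ∀ s o, FiniteMeanLength M (opt o) s)
include hlen

theorem exists_maxValue_sub_eq_const [DecidableEq O]
    (huni : ∀ δ : S → O, IsUnichain (inducedChain M opt (Policy.deterministic δ)))
    {q₁ q₂ : S → O → ℝ} (hdiff : ∀ s o, q₂ s o - q₁ s o =
      ∑ s', termProb M (opt o) s s' * (maxValue q₂ s' - maxValue q₁ s')) :
    ∃ b, ∀ s, maxValue q₂ s - maxValue q₁ s = b := by
  classical
  let g : S → ℝ := fun s => maxValue q₂ s - maxValue q₁ s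
  obtain ⟨δ₁, hδ₁⟩ := exists_forall_eq_maxValue q₁
  obtain ⟨δ₂, hδ₂⟩ := exists_forall_eq_maxValue q₂
  let δ : S → O := fun s => if ∃ x, g s < g x then δ₁ s else δ₂ s
  have hchain : ∀ s, (inducedChain M opt (Policy.deterministic δ) *ᵥ g) s =
      q₂ s (δ s) - q₁ s (δ s) := fun s =>
    (inducedChain_deterministic_mulVec M opt δ g s).trans (hdiff s (δ s)).symm
  refine (huni δ).exists_const (inducedChain_mem_rowStochastic hlen) (g := g)
    (fun s hs => ?_) fun s hs => ?_
  · have hδs : δ s = δ₂ s := if_neg (by simpa using hs)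
    rw [hchain, hδs, hδ₂]
    exact sub_le_sub_left (le_maxValue q₁ s _) _
  · have hδs : δ s = δ₁ s := if_pos hs
    rw [hchain, hδs, hδ₁]
    exact sub_le_sub_right (le_maxValue q₂ s _) _

theorem OptimalityEq.exists_eq_add_const [DecidableEq O]
    (huni : ∀ δ : S → O, IsUnichain (inducedChain M opt (Policy.deterministic δ)))
    {c : ℝ} {q₁ q₂ : S → O → ℝ} (hq₁ : OptimalityEq M opt c q₁) (hq₂ : OptimalityEq M opt c q₂) :
    ∃ b, ∀ s o, q₂ s o = q₁ s o + b := by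
  have hdiff : ∀ s o, q₂ s o - q₁ s o =
      ∑ s', termProb M (opt o) s s' * (maxValue q₂ s' - maxValue q₁ s') := fun s o =>
    eq_sum_termProb (fun s => hlen s o) (h := fun s => q₂ s o - q₁ s o) (fun s => by
      rw [(intraOptionEq_iff M opt).1 hq₁ s o, (intraOptionEq_iff M opt).1 hq₂ s o,
        ← Finset.sum_sub_distrib]
      refine Finset.sum_congr rfl fun z _ => ?_
      change _ * (_ - c + (_ + _ * maxValue q₂ z.2.1)) -
        _ * (_ - c + (_ + _ * maxValue q₁ z.2.1)) = _
      ring) s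
  obtain ⟨b, hb⟩ := exists_maxValue_sub_eq_const hlen huni hdiff
  refine ⟨b, fun s o => ?_⟩
  have hrow := sum_row_of_mem_rowStochastic (termProb_mem_rowStochastic fun s => hlen s o) s
  simp only [of_apply] at hrow
  rw [← sub_eq_iff_eq_add', hdiff]
  simp only [hb, ← Finset.sum_mul, hrow, one_mul]

theorem setOf_optimalityEq_eq [Nonempty S]
    (huni : ∀ μ : Policy S O, IsUnichain (inducedChain M opt μ)) {c : ℝ} {q₁ : S → O → ℝ}
    (hq₁ : OptimalityEq M opt c q₁) :
    {q : S → O → ℝ | ∃ c, OptimalityEq M opt c q} =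
      {q : S → O → ℝ | ∃ b, ∀ s o, q s o = q₁ s o + b} := by
  classical
  ext q
  refine ⟨fun ⟨c', hq⟩ => ?_, fun ⟨b, hb⟩ => ?_⟩
  · obtain rfl : c' = c :=
      (hq.optimalRate_eq hlen huni).symm.trans (hq₁.optimalRate_eq hlen huni)
    exact hq₁.exists_eq_add_const hlen (fun δ => huni _) hq
  · rw [show q = fun s o => q₁ s o + b from funext₂ hb]
    exact ⟨c, hq₁.add_const b⟩

end Uniqueness

end Optimality

end

end AvgOptions

theorem theorem2 {S A O : Type*} [Fintype S] [Fintype A] [Fintype O]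
    [DecidableEq S] [DecidableEq O] [Nonempty S] [Nonempty O]
    (M : FiniteMDP S A) (opt : O → TemporalOption S A)
    (hlen : ∀ s o, FiniteMeanLength M (opt o) s)
    (hunichain : ∀ μ : Policy S O, IsUnichain (inducedChain M opt μ)) :
    -- the reward rates, the optimal reward rate and the differential values are well defined
    ((∀ (μ : Policy S O) (s : S) (o : O),
        Tendsto (optionRatio M opt μ s o) atTop (𝓝 (rewardRate M opt μ)) ∧
        Tendsto (fun t : ℕ => expectedReturn M opt μ 0 s o t / t) atTop
          (𝓝 (rewardRate M opt μ)) ∧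
        Tendsto (cesaroReturn M opt μ s o) atTop (𝓝 (diffValue M opt μ s o))) ∧
      BddAbove (Set.range fun μ : Policy S O => rewardRate M opt μ)) ∧
    -- the optimality equation
    ((∃ (rbar : ℝ) (q : S → O → ℝ), OptimalityEq M opt rbar q) ∧
      (∀ (rbar : ℝ) (q : S → O → ℝ), OptimalityEq M opt rbar q → rbar = optimalRate M opt) ∧
      (∀ (rbar₁ : ℝ) (q₁ : S → O → ℝ), OptimalityEq M opt rbar₁ q₁ →
        {q : S → O → ℝ | ∃ rbar : ℝ, OptimalityEq M opt rbar q} =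
          {q : S → O → ℝ | ∃ c : ℝ, ∀ s o, q s o = q₁ s o + c}) ∧
      (∀ (rbar : ℝ) (q : S → O → ℝ) (μ : Policy S O), OptimalityEq M opt rbar q →
        IsGreedy μ q → rewardRate M opt μ = optimalRate M opt)) ∧
    -- the evaluation equation
    (∀ μ : Policy S O,
      (∃ (rbar : ℝ) (q : S → O → ℝ), EvaluationEq M opt μ rbar q) ∧
      (∀ (rbar : ℝ) (q : S → O → ℝ), EvaluationEq M opt μ rbar q →
        rbar = rewardRate M opt μ) ∧
      {q : S → O → ℝ | ∃ rbar : ℝ, EvaluationEq M opt μ rbar q} =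
        {q : S → O → ℝ | ∃ c : ℝ, ∀ s o, q s o = diffValue M opt μ s o + c}) := by
  have hsol : ∃ (c : ℝ) (q : S → O → ℝ), OptimalityEq M opt c q :=
    exists_optimalityEq fun δ => evaluationEq_diffValue hlen (hunichain (.deterministic δ))
  refine ⟨⟨fun μ s o => ?_, ?_⟩, ⟨hsol, fun c q hq => ?_, fun c q₁ hq₁ => ?_,
    fun c q μ hq hμ => ?_⟩, fun μ => ⟨?_, fun c q hq => ?_, ?_⟩⟩
  · have hμ := evaluationEq_diffValue hlen (hunichain μ)
    exact ⟨hμ.tendsto_optionRatio hlen s o, hμ.tendsto_expectedReturn_div s o,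
      tendsto_cesaroReturn hlen (hunichain μ) s o⟩
  · obtain ⟨c, q, hq⟩ := hsol
    exact ⟨c, (hq.isGreatest_range_rewardRate hlen hunichain).2⟩
  · exact (hq.optimalRate_eq hlen hunichain).symm
  · exact setOf_optimalityEq_eq hlen hunichain hq₁
  · exact (hq.rewardRate_eq hlen hμ).trans (hq.optimalRate_eq hlen hunichain).symm
  · exact exists_evaluationEq hlen (hunichain μ)
  · exact (hq.rewardRate_eq hlen).symm
  · exact setOf_evaluationEq_eq hlen (hunichain μ)
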